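/- All graphs are finite and simple, and $d\ge 1$. A realization of a graph $G=(V,E)$ in $\mathbb{C}^d$ is a map $p:V\to\mathbb{C}^d$; the pair $(G,p)$ is a framework. It is generic if the $d|V|$ coordinates of $p$ are algebraically independent over $\mathbb{Q}$. For $u,v\in V$ put $m_{uv}(p)=\sum_{k=1}^d (p(u)_k-p(v)_k)^2$ (no conjugation). Frameworks $(G,p)$ and $(G,q)$ are equivalent if $m_{uv}(p)=m_{uv}(q)$ for all $uv\in E$. Frameworks $(G,p)$ and $(H,q)$ are length-equivalent under a bijection $\psi:E(G)\to E(H)$ if $m_e(p)=m_{\psi(e)}(q)$ for every $e\in E(G)$. The bijection $\psi$ is induced by a graph isomorphism if there is an isomorphism $\varphi:V(G)\to V(H)$ with $\psi(uv)=\varphi(u)\varphi(v)$ for all $uv\in E(G)$. The graph $G$ is strongly reconstructible in $\mathbb{C}^d$ if, for every generic framework $(G,p)$ in $\mathbb{C}^d$ and every generic framework $(H,q)$ in $\mathbb{C}^d$ such that $H$ has the same number of vertices as $G$ and $(H,q)$ is length-equivalent to $(G,p)$ under some $\psi$, the bijection $\psi$ is induced by a graph isomorphism. The graph $G$ is fully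 reconstructible in $\mathbb{C}^d$ if $G$ has no isolated vertices and, for every generic framework $(G,p)$ in $\mathbb{C}^d$ and every generic framework $(H,q)$ in $\mathbb{C}^d$ such that $H$ (on any number of vertices) has no isolated vertices and $(H,q)$ is length-equivalent to $(G,p)$ under some $\psi$, the bijection $\psi$ is induced by a graph isomorphism. A pair $\{u,v\}$ of vertices is globally linked in $G$ in $\mathbb{C}^d$ if $m_{uv}(p)=m_{uv}(q)$ for every generic framework $(G,p)$ in $\mathbb{C}^d$ and every (not necessarily generic) framework $(G,q)$ in $\mathbb{C}^d$ equivalent to $(G,p)$. Lemma. Let $G$ be a graph and let $\{u,v\}$ be a pair of vertices that is globally linked in $G$ in $\mathbb{C}^d$. If $G$ is strongly reconstructible in $\mathbb{C}^d$, then so is $G+uv$. If $G$ is fully reconstructible in $\mathbb{C}^d$, then so is $G+uv$. (If $uv$ is already an edge of $G$, then $G+uv=G$.) -/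

import Mathlib

universe u

namespace Rigidity

/-- A realization of a graph with vertex set `V` in `ℂ^d`. -/
abbrev Config (V : Type u) (d : ℕ) : Type u := V → Fin d → ℂ

/-- The complex squared distance `∑ₖ (p(u)ₖ - p(v)ₖ)²` (without conjugation). -/
noncomputable def sqDist {V : Type u} {d : ℕ} (p : Config V d) (u v : V) : ℂ :=
  ∑ k : Fin d, (p u k - p v k) ^ 2

/-- The complex squared distance as a function of the unordered pair. -/
noncomputable def sqLength {V : Type u} {d : ℕ} (p : Config V d) : Sym2 V → ℂ :=
  Sym2.lift ⟨sqDist p, fun u v => by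
    unfold sqDist
    exact Finset.sum_congr rfl fun k _ => by ring⟩

/-- The rigidity (edge measurement) map `m_{d,G} : (ℂ^d)^V → ℂ^E`. -/
noncomputable def rigidityMap {V : Type u} {d : ℕ} (G : SimpleGraph V) (p : Config V d) :
    G.edgeSet → ℂ :=
  fun e => sqLength p e

/-- A configuration is generic if its `|V| ⬝ d` coordinates are algebraically independent
over `ℚ`. -/
def IsGeneric {V : Type u} {d : ℕ} (p : Config V d) : Prop :=
  AlgebraicIndependent ℚ fun x : V × Fin d => p x.1 x.2

/-- The frameworks `(G, p)` and `(G, q)` are equivalent: they have the same edge lengths. -/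
def Equivalent {V : Type u} {d : ℕ} (G : SimpleGraph V) (p q : Config V d) : Prop :=
  rigidityMap G p = rigidityMap G q

/-- The frameworks `(G, p)` and `(H, q)` are length-equivalent under the edge bijection `ψ`. -/
def LengthEquivalent {V W : Type u} {d : ℕ} (G : SimpleGraph V) (p : Config V d)
    (H : SimpleGraph W) (q : Config W d) (ψ : G.edgeSet ≃ H.edgeSet) : Prop :=
  ∀ e : G.edgeSet, rigidityMap G p e = rigidityMap H q (ψ e)

/-- The edge bijection `ψ` is induced by a graph isomorphism `φ`: `ψ(uv) = φ(u)φ(v)` for every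
edge `uv` of `G`. -/
def InducedByIso {V W : Type u} (G : SimpleGraph V) (H : SimpleGraph W)
    (ψ : G.edgeSet ≃ H.edgeSet) : Prop :=
  ∃ φ : G ≃g H, ∀ (u v : V) (h : G.Adj u v),
    (ψ ⟨s(u, v), G.mem_edgeSet.2 h⟩ : Sym2 W) = s(φ u, φ v)

/-- No vertex of `G` is isolated. -/
def NoIsolatedVertices {V : Type u} (G : SimpleGraph V) : Prop :=
  ∀ v : V, ¬ G.IsIsolated v

/-- Strong reconstructibility of a (generic) framework `(G, p)`. Only finite graphs `H` are
considered. -/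
def FrameworkStronglyReconstructible {V : Type u} {d : ℕ} (G : SimpleGraph V)
    (p : Config V d) : Prop :=
  ∀ (W : Type u) [Finite W] (H : SimpleGraph W) (q : Config W d) (ψ : G.edgeSet ≃ H.edgeSet),
    Nat.card W = Nat.card V → IsGeneric q → LengthEquivalent G p H q ψ → InducedByIso G H ψ

/-- Full reconstructibility of a (generic) framework `(G, p)`, where `G` has no isolated
vertices: `H` may have any finite number of vertices, none of them isolated. -/
def FrameworkFullyReconstructible {V : Type u} {d : ℕ} (G : SimpleGraph V)
    (p : Config V d) : Prop :=
  ∀ (W : Type u) [Finite W] (H : SimpleGraph W) (q : Config W d) (ψ : G.edgeSet ≃ H.edgeSet),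
    NoIsolatedVertices H → IsGeneric q → LengthEquivalent G p H q ψ → InducedByIso G H ψ

/-- `G` is (generically) strongly reconstructible in `ℂ^d`. -/
def StronglyReconstructible {V : Type u} (d : ℕ) (G : SimpleGraph V) : Prop :=
  ∀ p : Config V d, IsGeneric p → FrameworkStronglyReconstructible G p

/-- `G` is (generically) fully reconstructible in `ℂ^d`; this includes that `G` has no isolated
vertices. -/
def FullyReconstructible {V : Type u} (d : ℕ) (G : SimpleGraph V) : Prop :=
  NoIsolatedVertices G ∧ ∀ p : Config V d, IsGeneric p → FrameworkFullyReconstructible G p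

/-- The pair `{u, v}` is globally linked in `G` in `ℂ^d`. The second realization `q` need not be
generic. -/
def GloballyLinked {V : Type u} (d : ℕ) (G : SimpleGraph V) (u v : V) : Prop :=
  ∀ p : Config V d, IsGeneric p → ∀ q : Config V d, Equivalent G p q →
    sqDist p u v = sqDist q u v

end Rigidity

namespace Rigidity

/-! Remove `uv` and its image `ψ(uv)`. What remains of `ψ` preserves lengths, so reconstructibility
of `G` yields an isomorphism `φ` inducing it. The pullback `q ∘ φ` is equivalent to `p` on `G`, so
global linkedness gives `φ(u)φ(v)` the same length in `q` as `ψ(uv)`. Since `q` is generic, distinct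
pairs have distinct lengths; hence `ψ(uv) = φ(u)φ(v)`, and `φ` induces all of `ψ`
(`inducedByIso_sup_edge`). In the full case, removing `ψ(uv)` may isolate its endpoints, so `φ` maps
onto a vertex set `S` that may omit them; the same identity puts them back in `S`. -/

lemma sqLength_mk {V : Type u} {d : ℕ} (p : Config V d) (a b : V) :
    sqLength p s(a, b) = sqDist p a b := rfl

lemma sqLength_comp {V W : Type u} {d : ℕ} (q : Config W d) (f : V → W) (e : Sym2 V) :
    sqLength (fun x => q (f x)) e = sqLength q (e.map f) := by
  induction e using Sym2.ind with
  | _ a b => rfl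

/-- An identity between two squared distances in a generic configuration holds in every
rational configuration. -/
lemma IsGeneric.sqDist_rat_eq {W : Type u} {d : ℕ} {q : Config W d} (hq : IsGeneric q)
    {a b a' b' : W} (h : sqDist q a b = sqDist q a' b') (r : W → Fin d → ℚ) :
    ∑ k, (r a k - r b k) ^ 2 = ∑ k, (r a' k - r b' k) ^ 2 := by
  let P : W → W → MvPolynomial (W × Fin d) ℚ := fun x y =>
    ∑ k, (MvPolynomial.X (x, k) - MvPolynomial.X (y, k)) ^ 2
  have hP : P a b = P a' b' := hq (by simpa [P, sqDist] using h)
  simpa [P] using congrArg (MvPolynomial.aeval fun x : W × Fin d => r x.1 x.2) hP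

lemma IsGeneric.mem_of_sqDist_eq {W : Type u} {d : ℕ} (hd : 1 ≤ d) {q : Config W d}
    (hq : IsGeneric q) {a b a' b' : W} (hab : a ≠ b) (h : sqDist q a b = sqDist q a' b') :
    a = a' ∨ a = b' := by
  classical
  by_contra! hne
  -- At the indicator of `a` in every coordinate, the left side is `d` and the right side is `0`.
  have := hq.sqDist_rat_eq h fun x _ => if x = a then 1 else 0
  simp [hab.symm, hne.1.symm, hne.2.symm] at this
  omega

/-- In a generic configuration, distinct pairs of distinct points have distinct squared
distances. -/
lemma IsGeneric.sym2_eq_of_sqDist_eq_sqLength {W : Type u} {d : ℕ} (hd : 1 ≤ d) {q : Config W d}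
    (hq : IsGeneric q) {a b : W} (hab : a ≠ b) {t : Sym2 W} (h : sqDist q a b = sqLength q t) :
    s(a, b) = t := by
  induction t using Sym2.ind with | _ a' b' => ?_
  rw [sqLength_mk] at h
  have ha := hq.mem_of_sqDist_eq hd hab h
  have hb := hq.mem_of_sqDist_eq hd hab.symm
    (show sqDist q b a = sqDist q a' b' by
      rw [← h, ← sqLength_mk, ← sqLength_mk, Sym2.eq_swap])
  rw [Sym2.eq_iff]
  grind

/-- Adjacency is reflected because `ψ` is surjective and `f` is injective on unordered pairs. -/
lemma inducedByIso_of_equiv {V W : Type u} {G : SimpleGraph V} {H : SimpleGraph W}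
    {ψ : G.edgeSet ≃ H.edgeSet} (f : V ≃ W)
    (hf : ∀ e : G.edgeSet, (ψ e : Sym2 W) = (e : Sym2 V).map f) : InducedByIso G H ψ := by
  refine ⟨⟨f, fun {a b} => ⟨fun h => ?_, fun h => ?_⟩⟩, fun a b h => hf _⟩
  · have h1 := hf (ψ.symm ⟨s(f a, f b), h⟩)
    rw [Equiv.apply_symm_apply] at h1
    have h2 : s(a, b) = (ψ.symm ⟨s(f a, f b), h⟩ : Sym2 V) :=
      Sym2.map.injective f.injective h1
    rw [← SimpleGraph.mem_edgeSet, h2]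
    exact (ψ.symm _).2
  · have h1 := hf ⟨s(a, b), h⟩
    rw [← SimpleGraph.mem_edgeSet]
    change (s(a, b) : Sym2 V).map f ∈ H.edgeSet
    rw [← h1]
    exact (ψ ⟨s(a, b), h⟩).2

/-- Deleting an edge and its image restricts an edge bijection, where the target may be
shrunk to any vertex set containing the endpoints of all remaining edges. -/
lemma exists_edge_equiv_restrict {V W : Type u} {G G' : SimpleGraph V} {H : SimpleGraph W}
    (hle : G ≤ G') (ψ : G'.edgeSet ≃ H.edgeSet) (e : G'.edgeSet) (he : (e : Sym2 V) ∉ G.edgeSet)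
    (hG : ∀ z : G'.edgeSet, z ≠ e → (z : Sym2 V) ∈ G.edgeSet) (S : Set W)
    (hS : ∀ a b, (H.deleteEdges {(ψ e : Sym2 W)}).Adj a b → a ∈ S) :
    ∃ χ : G.edgeSet ≃ ((H.deleteEdges {(ψ e : Sym2 W)}).induce S).edgeSet,
      ∀ z : G.edgeSet, (ψ ⟨z, SimpleGraph.edgeSet_mono hle z.2⟩ : Sym2 W) =
        (χ z : Sym2 S).map Subtype.val := by
  -- The bijection is built from the target back to `G`, where `ψ.symm` applies directly; `hS` is
  -- needed only for surjectivity.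
  have key : ∀ z : ((H.deleteEdges {(ψ e : Sym2 W)}).induce S).edgeSet, ∃ y : G.edgeSet,
      (ψ ⟨y, SimpleGraph.edgeSet_mono hle y.2⟩ : Sym2 W) = (z : Sym2 S).map Subtype.val := by
    rintro ⟨z, hz⟩
    have hz' : z.map Subtype.val ∈ (H.deleteEdges {(ψ e : Sym2 W)}).edgeSet := by
      induction z using Sym2.ind with
      | _ a b => exact hz
    rw [SimpleGraph.edgeSet_deleteEdges] at hz'
    refine ⟨⟨ψ.symm ⟨_, hz'.1⟩, hG _ fun h => hz'.2 ?_⟩, by simp⟩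
    rw [← h]
    simp
  choose g hg using key
  have hbij : Function.Bijective g := by
    constructor
    · intro x y hxy
      have := (hg x).symm.trans ((congrArg (fun t : G.edgeSet =>
        (ψ ⟨t, SimpleGraph.edgeSet_mono hle t.2⟩ : Sym2 W)) hxy).trans (hg y))
      exact Subtype.ext (Sym2.map.injective Subtype.val_injective this)
    · intro y
      have hmem : (ψ ⟨y, SimpleGraph.edgeSet_mono hle y.2⟩ : Sym2 W) ∈
          (H.deleteEdges {(ψ e : Sym2 W)}).edgeSet := by
        rw [SimpleGraph.edgeSet_deleteEdges]
        refine ⟨(ψ _).2, fun h => he ?_⟩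
        have := ψ.injective (Subtype.ext h)
        rw [← this]
        exact y.2
      obtain ⟨x, hx⟩ : ∃ x : ((H.deleteEdges {(ψ e : Sym2 W)}).induce S).edgeSet,
          (x : Sym2 S).map Subtype.val = (ψ ⟨y, SimpleGraph.edgeSet_mono hle y.2⟩ : Sym2 W) := by
        generalize (ψ ⟨y, SimpleGraph.edgeSet_mono hle y.2⟩ : Sym2 W) = t at hmem
        induction t using Sym2.ind with
        | _ a b =>
          have hab : (H.deleteEdges {(ψ e : Sym2 W)}).Adj a b := hmem
          exact ⟨⟨s(⟨a, hS a b hab⟩, ⟨b, hS b a hab.symm⟩), hab⟩, rfl⟩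
      refine ⟨x, Subtype.ext ?_⟩
      have := ψ.injective (Subtype.ext ((hg x).trans hx))
      exact congrArg (fun t : G'.edgeSet => (t : Sym2 V)) this
  refine ⟨(Equiv.ofBijective g hbij).symm, fun z => ?_⟩
  rw [← hg]
  congr 3
  exact congrArg Subtype.val ((Equiv.ofBijective g hbij).apply_symm_apply z).symm

lemma IsGeneric.comp_injective {V W : Type u} {d : ℕ} {q : Config W d} (hq : IsGeneric q)
    {f : V → W} (hf : Function.Injective f) : IsGeneric fun x => q (f x) :=
  AlgebraicIndependent.comp hq (Prod.map f id) (hf.prodMap Function.injective_id)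

lemma sup_edge_mem {V : Type u} {G : SimpleGraph V} {u v : V} (z : Sym2 V)
    (hz : z ∈ (G ⊔ SimpleGraph.edge u v).edgeSet) (hne : z ≠ s(u, v)) : z ∈ G.edgeSet := by
  induction z using Sym2.ind with
  | _ a b =>
    rw [SimpleGraph.mem_edgeSet, SimpleGraph.sup_adj, SimpleGraph.edge_adj] at hz
    rcases hz with hz | hz
    · exact hz
    · exact absurd (Sym2.eq_iff.2 (by tauto)) hne

/-- If every length-preserving edge bijection from `G` to `H - ψ(uv)`, restricted to a vertex set
`S` missing at most endpoints of `ψ(uv)`, is induced by an isomorphism, then so is `ψ`. -/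
lemma inducedByIso_sup_edge {V W : Type u} {d : ℕ} (hd : 1 ≤ d) {G : SimpleGraph V} {u v : V}
    (hlinked : GloballyLinked d G u v) (huv : u ≠ v) (hadj : ¬ G.Adj u v)
    {p : Config V d} (hp : IsGeneric p) {H : SimpleGraph W} {q : Config W d} (hq : IsGeneric q)
    (ψ : (G ⊔ SimpleGraph.edge u v).edgeSet ≃ H.edgeSet)
    (hψ : LengthEquivalent (G ⊔ SimpleGraph.edge u v) p H q ψ)
    (e : (G ⊔ SimpleGraph.edge u v).edgeSet) (he : (e : Sym2 V) = s(u, v)) (S : Set W)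
    (hS : ∀ a b, (H.deleteEdges {(ψ e : Sym2 W)}).Adj a b → a ∈ S)
    (hSc : ∀ w, w ∉ S → w ∈ (ψ e : Sym2 W))
    (hrec : ∀ χ : G.edgeSet ≃ ((H.deleteEdges {(ψ e : Sym2 W)}).induce S).edgeSet,
      LengthEquivalent G p ((H.deleteEdges {(ψ e : Sym2 W)}).induce S) (fun x : S => q x) χ →
      InducedByIso G ((H.deleteEdges {(ψ e : Sym2 W)}).induce S) χ) :
    InducedByIso (G ⊔ SimpleGraph.edge u v) H ψ := by
  obtain ⟨χ, hχ⟩ := exists_edge_equiv_restrict le_sup_left ψ e (by rw [he]; exact hadj)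
    (fun z hz => sup_edge_mem _ z.2 fun h => hz (Subtype.ext (h.trans he.symm))) S hS
  have hlen : ∀ z : G.edgeSet, sqLength p z = sqLength q ((χ z : Sym2 S).map Subtype.val) := by
    intro z
    rw [← hχ]
    exact hψ ⟨z, _⟩
  obtain ⟨φ, hφ⟩ := hrec χ fun z => (hlen z).trans (sqLength_comp q Subtype.val _).symm
  have hφ' : ∀ z : G.edgeSet, (ψ ⟨z, SimpleGraph.edgeSet_mono le_sup_left z.2⟩ : Sym2 W) =
      (z : Sym2 V).map fun x => (φ x : W) := by
    rintro ⟨z, hz⟩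
    induction z using Sym2.ind with
    | _ a b => rw [hχ, hφ a b hz]; rfl
  have hequiv : Equivalent G p fun x => q (φ x) := by
    funext z
    change sqLength p z = sqLength (fun x => q (φ x)) z
    rw [sqLength_comp q (fun x => (φ x : W)), ← hφ' z, hlen, hχ]
  have hψe : (ψ e : Sym2 W) = s((φ u : W), (φ v : W)) := by
    have h1 : sqDist p u v = sqLength q (ψ e) := by
      rw [← sqLength_mk, ← he]
      exact hψ e
    have h2 : sqDist q (φ u) (φ v) = sqLength q (ψ e) := (hlinked p hp _ hequiv).symm.trans h1
    have hne : (φ u : W) ≠ φ v := fun h => huv (φ.injective (Subtype.ext h))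
    exact (hq.sym2_eq_of_sqDist_eq_sqLength hd hne h2).symm
  -- A vertex outside `S` would be an endpoint of `ψ e`, hence `φ u` or `φ v`, which lie in `S`.
  have hmem : ∀ w, w ∈ S := by
    intro w
    by_contra hw
    have := hSc w hw
    rw [hψe, Sym2.mem_iff] at this
    rcases this with rfl | rfl
    exacts [hw (φ u).2, hw (φ v).2]
  refine inducedByIso_of_equiv (φ.toEquiv.trans (Equiv.subtypeUnivEquiv hmem)) fun z => ?_
  by_cases hz : z = e
  · subst hz
    exact hψe.trans (congrArg (Sym2.map fun x => (φ x : W)) he).symm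
  · exact hφ' ⟨z, sup_edge_mem _ z.2 fun h => hz (Subtype.ext (h.trans he.symm))⟩

end Rigidity

open Rigidity in
theorem lemma4p8 {V : Type u} [Finite V] (d : ℕ) (hd : 1 ≤ d) (G : SimpleGraph V) (u v : V)
    (hlinked : Rigidity.GloballyLinked d G u v) :
    (Rigidity.StronglyReconstructible d G →
      Rigidity.StronglyReconstructible d (G ⊔ SimpleGraph.edge u v)) ∧
    (Rigidity.FullyReconstructible d G →
      Rigidity.FullyReconstructible d (G ⊔ SimpleGraph.edge u v)) := by
  -- This also covers `u = v`, where `edge u v` is empty.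
  by_cases hle : SimpleGraph.edge u v ≤ G
  · rw [sup_eq_left.2 hle]
    exact ⟨id, id⟩
  have huv : u ≠ v := by
    rintro rfl
    simp at hle
  have hadj : ¬ G.Adj u v := fun h => hle <| by
    rw [SimpleGraph.edge_le_iff]
    exact Or.inr h
  let e : (G ⊔ SimpleGraph.edge u v).edgeSet :=
    ⟨s(u, v), Or.inr (by simp [SimpleGraph.edge_adj, huv])⟩
  refine ⟨fun hG p hp W _ H q ψ hcard hq hψ => ?_, fun hG => ⟨fun x hx => ?_,
    fun p hp W _ H q ψ hH hq hψ => ?_⟩⟩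
  -- All vertices are kept, so the vertex count is unchanged.
  · exact inducedByIso_sup_edge hd hlinked huv hadj hp hq ψ hψ e rfl Set.univ
      (fun _ _ _ => trivial) (fun w hw => absurd trivial hw) fun χ hχ =>
      hG p hp _ _ _ χ ((Nat.card_congr (Equiv.Set.univ W)).trans hcard)
        (hq.comp_injective Subtype.val_injective) hχ
  · exact hG.1 x fun y hy => hx y (Or.inl hy)
  -- Restricting to the support discards the vertices isolated by the deletion; as `H` has no
  -- isolated vertices, these are endpoints of `ψ e`.
  · refine inducedByIso_sup_edge hd hlinked huv hadj hp hq ψ hψ e rfl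
      (H.deleteEdges {(ψ e : Sym2 W)}).support (fun a b h => ⟨b, h⟩) (fun w hw => ?_)
      fun χ hχ => hG.2 p hp _ _ _ χ ?_ (hq.comp_injective Subtype.val_injective) hχ
    · by_contra hwe
      refine hH w fun y hy => hw ⟨y, ?_⟩
      refine SimpleGraph.deleteEdges_adj.2 ⟨hy, fun h => hwe ?_⟩
      rw [← Set.mem_singleton_iff.1 h]
      exact Sym2.mem_mk_left w y
    · rintro ⟨w, y, hy⟩ hw
      have hyw : (H.deleteEdges {(ψ e : Sym2 W)}).Adj y w := SimpleGraph.Adj.symm hy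
      exact hw ⟨y, w, hyw⟩ hy
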